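/- Let $H$ be a complex Hilbert space and let $A\subset B(H)$ be an approximately unital operator algebra, that is, a norm-closed (not necessarily selfadjoint or unital) associative subalgebra of $B(H)$ possessing a net $(e_t)$ with $\|e_t\|\le 1$, $e_ta\to a$ and $ae_t\to a$ for all $a\in A$. Let $P:A\to A$ be a real positive contractive projection, that is, a linear map with $P\circ P=P$, $\|P(a)\|\le\|a\|$ for all $a \in A$, and such that $P(a)+P(a)^*\ge 0$ whenever $a\in A$ and $a+a^*\ge 0$. The $P$-product on $P(A)$ is the bilinear map $(x,y)\mapsto P(xy)$. Let $A^1=A\oplus\mathbb{C}1$ be the unitization of $A$ (with a new identity adjoined), and write $P$ also for the unital linear extension $a+\lambda 1\mapsto P(a)+\lambda 1$ of $P$ to $A^1$. Define $$N=\{x\in A: P(xy)=P(yx)=0\ \text{for all } y\in A^1\},$$ $$B=\{x\in A: P(xy)=P(P(x)P(y))\ \text{and}\ P(yx)=P(P(y)P(x))\ \text{for all } y\in A\}.$$ (If $A$ has an identity, then one may equivalently let $y$ range over $A$ in the definition of $N$.) Then the following are equivalent: 1. $P(A)\subset B$; 2. $P$ is a conditional expectation onto $P(A)$ with respect to the $P$-product,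 that is, $P(P(a)b)=P(P(a)P(b))=P(aP(b))$ for all $a,b\in A$; 3. $B=P(A)+N$. If these hold, then $P(A)$ with the $P$-product and the norm inherited from $A$ is isometrically isomorphic to an operator algebra (there are a complex Hilbert space $K$, a norm-closed subalgebra $D\subset B(K)$ and a surjective linear isometry $\varphi:P(A)\to D$ with $\varphi(P(xy))=\varphi(x)\varphi(y)$ for all $x,y\in P(A)$); moreover $B$ is a subalgebra of $A$ containing $P(A)$, and $P$ is a homomorphism from $B$ onto $P(A)$ with the $P$-product. -/

import Mathlib

open scoped Pointwise

universe u

/-- A bounded operator `T` on a complex Hilbert space is real positive (accretive) if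
`T + T* ≥ 0` in the Loewner order. -/
def RealPositive {H : Type*} [NormedAddCommGroup H] [InnerProductSpace ℂ H] [CompleteSpace H]
    (T : H →L[ℂ] H) : Prop :=
  (T + ContinuousLinearMap.adjoint T).IsPositive

/-- An operator algebra on `H`: a norm closed, not necessarily selfadjoint and not necessarily
unital, associative subalgebra of `B(H)`. -/
def IsOperatorAlgebra {H : Type*} [NormedAddCommGroup H] [InnerProductSpace ℂ H]
    [CompleteSpace H] (A : NonUnitalSubalgebra ℂ (H →L[ℂ] H)) : Prop :=
  IsClosed (A : Set (H →L[ℂ] H))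

/-- `A` has a (two-sided) contractive approximate identity. -/
def ApproximatelyUnital {H : Type*} [NormedAddCommGroup H] [InnerProductSpace ℂ H]
    [CompleteSpace H] (A : NonUnitalSubalgebra ℂ (H →L[ℂ] H)) : Prop :=
  ∃ l : Filter A, l.IsApproximateUnit ∧ ∀ᶠ e in l, ‖e‖ ≤ 1

/-- `P` is a contractive real positive projection (idempotent linear map) on `A`. -/
structure IsRealPositiveContractiveProjection {H : Type*} [NormedAddCommGroup H]
    [InnerProductSpace ℂ H] [CompleteSpace H] {A : NonUnitalSubalgebra ℂ (H →L[ℂ] H)}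
    (P : A →ₗ[ℂ] A) : Prop where
  idempotent : ∀ a, P (P a) = P a
  contractive : ∀ a, ‖P a‖ ≤ ‖a‖
  realPositive : ∀ a : A, RealPositive (a : H →L[ℂ] H) → RealPositive (P a : H →L[ℂ] H)

section Algebraic

variable {A : Type*} [NonUnitalRing A] [Module ℂ A]

/-- The unital extension `λ 1 + a ↦ λ 1 + P a` of `P` to the unitization `A¹ = ℂ 1 ⊕ A`. -/
def unitalExtension (P : A →ₗ[ℂ] A) : Unitization ℂ A →ₗ[ℂ] Unitization ℂ A where
  toFun z := Unitization.inl z.fst + Unitization.inr (P z.snd)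
  map_add' z w := by ext <;> simp
  map_smul' c z := by ext <;> simp

/-- `N = {x ∈ A : P(xy) = P(yx) = 0 for all y ∈ A¹}`, where `P` also denotes the unital extension
of `P` to the unitization `A¹ ≠ A`. -/
def projN (P : A →ₗ[ℂ] A) : Set A :=
  {x | ∀ y : Unitization ℂ A, unitalExtension P (Unitization.inr x * y) = 0 ∧
    unitalExtension P (y * Unitization.inr x) = 0}

/-- If `A` has an identity element, then in the definition of `N` one may let `y` range over `A`
itself, as is usual for unital algebras. -/
theorem mem_projN_iff_of_identity (P : A →ₗ[ℂ] A) (e : A) (he : ∀ a, e * a = a ∧ a * e = a)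
    (x : A) : x ∈ projN P ↔ ∀ y : A, P (x * y) = 0 ∧ P (y * x) = 0 := by
  have key : ∀ y : Unitization ℂ A, (unitalExtension P (Unitization.inr x * y) = 0 ∧
      unitalExtension P (y * Unitization.inr x) = 0) ↔
      (y.fst • P x + P (x * y.snd) = 0 ∧ y.fst • P x + P (y.snd * x) = 0) := by
    intro y
    simp [unitalExtension, Unitization.ext_iff]
  constructor
  · intro h y
    simpa using (key (Unitization.inr y)).1 (h _)
  · intro h y
    have hx : P x = 0 := by simpa [(he x).2] using (h e).1
    exact (key y).2 (by simp [hx, h y.snd])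

/-- `B = {x ∈ A : P(xy) = P(P(x)P(y)) and P(yx) = P(P(y)P(x)) for all y ∈ A}`. -/
def projB (P : A →ₗ[ℂ] A) : Set A :=
  {x | ∀ y, P (x * y) = P (P x * P y) ∧ P (y * x) = P (P y * P x)}

/-- The `P`-product `(x, y) ↦ P(xy)` on the range `P(A)`. -/
def pProduct (P : A →ₗ[ℂ] A) (x y : LinearMap.range P) : LinearMap.range P :=
  P.rangeRestrict ((x : A) * (y : A))

/-- `P` is a conditional expectation onto `P(A)` with respect to the `P`-product. -/
def IsPConditionalExpectation (P : A →ₗ[ℂ] A) : Prop :=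
  ∀ a b, P (P a * b) = P (P a * P b) ∧ P (P a * P b) = P (a * P b)

end Algebraic

/-!
When `P(A) ⊆ B`, the kernel of `P` on `B` is an ideal `J` and `P(A)` with the `P`-product is the
quotient algebra `B / J`; the norms agree because `P` is contractive. It remains to represent a
quotient of an operator algebra isometrically. A functional of norm at most one that vanishes on
`J` is a coefficient `⟪η, ρ(·) ξ⟫` of a representation `ρ` of `B(H)`: half of it is the
off-diagonal corner of a state on `B(H ⊕ H)`, to which the GNS construction applies. Compressing
`ρ` to the orthogonal complement of the closure of `ρ(J)ξ`, and then restricting to the vectors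
killed by `J`, annihilates `J` without changing the coefficient. The direct sum of the
representations obtained from norming functionals has the quotient norm.
-/

universe v

open ContinuousLinearMap
open scoped ComplexOrder InnerProductSpace

section State

variable {M : Type u} [CStarAlgebra M] [PartialOrder M] [StarOrderedRing M]

theorem norm_algebraMap_sub_sq_le_of_nonneg_add_star {T : M} (hT : 0 ≤ T + star T) {t : ℝ}
    (ht : 0 ≤ t) : ‖algebraMap ℝ M t - T‖ ^ 2 ≤ t ^ 2 + ‖T‖ ^ 2 := by
  have expand : star (algebraMap ℝ M t - T) * (algebraMap ℝ M t - T) =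
      algebraMap ℝ M (t ^ 2) + star T * T - t • (T + star T) := by
    simp only [Algebra.algebraMap_eq_smul_one, star_sub, star_smul, star_one, star_trivial,
      sub_mul, mul_sub, smul_mul_assoc, mul_smul_comm, one_mul, mul_one, smul_smul, smul_add,
      smul_sub, sq]
    abel
  rw [sq, ← CStarRing.norm_star_mul_self]
  refine (CStarAlgebra.norm_le_iff_le_algebraMap _ (by positivity) (star_mul_self_nonneg _)).2 ?_
  calc star (algebraMap ℝ M t - T) * (algebraMap ℝ M t - T)
      ≤ algebraMap ℝ M (t ^ 2) + star T * T := expand.trans_le (sub_le_self _ (smul_nonneg ht hT))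
    _ ≤ algebraMap ℝ M (t ^ 2) + algebraMap ℝ M (‖T‖ ^ 2) := by
      gcongr
      exact CStarAlgebra.star_mul_le_algebraMap_norm_sq
    _ = algebraMap ℝ M (t ^ 2 + ‖T‖ ^ 2) := (map_add _ _ _).symm

theorem re_nonneg_of_norm_le_one_of_map_one {f : StrongDual ℂ M} (hf : ‖f‖ ≤ 1) (h1 : f 1 = 1)
    {T : M} (hT : 0 ≤ T + star T) : 0 ≤ (f T).re := by
  by_contra! hneg
  set t : ℝ := (‖T‖ ^ 2 + 1) / (-2 * (f T).re) with ht
  have ht0 : 0 ≤ t := div_nonneg (by positivity) (by linarith)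
  have htT : -2 * t * (f T).re = ‖T‖ ^ 2 + 1 := by
    have hne := hneg.ne
    rw [ht]
    field_simp
  have hle : t - (f T).re ≤ ‖algebraMap ℝ M t - T‖ := calc
    t - (f T).re = (f (algebraMap ℝ M t - T)).re := by
      simp [Algebra.algebraMap_eq_smul_one, ← Complex.coe_smul, h1]
    _ ≤ ‖f (algebraMap ℝ M t - T)‖ := Complex.re_le_norm _
    _ ≤ ‖algebraMap ℝ M t - T‖ := by simpa only [one_mul] using f.le_of_opNorm_le hf _
  have hsq := pow_le_pow_left₀ (by linarith) hle 2
  nlinarith [norm_algebraMap_sub_sq_le_of_nonneg_add_star hT ht0, sq_nonneg (f T).re]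

theorem map_nonneg_of_norm_le_one_of_map_one {f : StrongDual ℂ M} (hf : ‖f‖ ≤ 1) (h1 : f 1 = 1)
    {a : M} (ha : 0 ≤ a) : 0 ≤ f a := by
  have hsa : star a = a := (IsSelfAdjoint.of_nonneg ha).star_eq
  have hre : 0 ≤ (f a).re := re_nonneg_of_norm_le_one_of_map_one hf h1 (by
    rw [hsa]
    exact add_nonneg ha ha)
  have him : 0 ≤ (f (Complex.I • a)).re :=
    re_nonneg_of_norm_le_one_of_map_one hf h1 (by simp [star_smul, hsa])
  have him' : 0 ≤ (f (-(Complex.I • a))).re :=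
    re_nonneg_of_norm_le_one_of_map_one hf h1 (by simp [star_smul, hsa])
  simp only [map_neg, map_smul, smul_eq_mul, Complex.neg_re, Complex.I_mul_re] at him him'
  exact Complex.nonneg_iff.2 ⟨hre, by linarith⟩

theorem exists_gns_representation {f : StrongDual ℂ M} (hf : ‖f‖ ≤ 1) (h1 : f 1 = 1) :
    ∃ (K : Type u) (_ : NormedAddCommGroup K) (_ : InnerProductSpace ℂ K) (_ : CompleteSpace K)
      (π : M →⋆ₐ[ℂ] (K →L[ℂ] K)) (Ω : K), ∀ a, ⟪Ω, π a Ω⟫_ℂ = f a := by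
  let F : M →ₚ[ℂ] ℂ := PositiveLinearMap.mk₀ (f : M →ₗ[ℂ] ℂ)
    fun _ => map_nonneg_of_norm_le_one_of_map_one hf h1
  refine ⟨F.GNS, inferInstance, inferInstance, inferInstance, F.gnsStarAlgHom,
    (F.toPreGNS 1 : F.GNS), fun a => ?_⟩
  have : F a = f a := rfl
  simp [PositiveLinearMap.preGNS_inner_def, this]

theorem exists_representation_inner_eq_map_star_mul_mul {f : StrongDual ℂ M} (hf : ‖f‖ ≤ 1)
    (h1 : f 1 = 1) {X Y : M} (hXY : star X * X + star Y * Y = 1) :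
    ∃ (K : Type u) (_ : NormedAddCommGroup K) (_ : InnerProductSpace ℂ K) (_ : CompleteSpace K)
      (π : M →⋆ₐ[ℂ] (K →L[ℂ] K)) (ξ η : K),
      ‖η‖ ^ 2 + ‖ξ‖ ^ 2 = 1 ∧ ∀ a, ⟪η, π a ξ⟫_ℂ = f (star X * a * Y) := by
  obtain ⟨K, _, _, _, π, Ω, hπ⟩ := exists_gns_representation hf h1
  have inner_π : ∀ S T U, ⟪π S Ω, π T (π U Ω)⟫_ℂ = f (star S * T * U) := fun S T U => by
    rw [← hπ, map_mul, map_mul, map_star, star_eq_adjoint, mul_assoc, mul_apply_eq_comp,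
      adjoint_inner_right, mul_apply_eq_comp]
  have norm_π : ∀ S, ((‖π S Ω‖ ^ 2 : ℝ) : ℂ) = f (star S * S) := fun S => by
    simpa [inner_self_eq_norm_sq_to_K] using inner_π S 1 S
  refine ⟨K, inferInstance, inferInstance, inferInstance, π, π Y Ω, π X Ω, ?_,
    fun a => inner_π X a Y⟩
  apply Complex.ofReal_injective
  rw [Complex.ofReal_add, norm_π, norm_π, ← map_add, hXY, h1, Complex.ofReal_one]

end State

section Corner

set_option maxSynthPendingDepth 3

variable {H : Type u} [NormedAddCommGroup H] [InnerProductSpace ℂ H]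

variable (H) in
/-- The inclusion of `H` as the first summand of the Hilbert space `H ⊕ H`. -/
noncomputable def directSumInl : H →L[ℂ] WithLp 2 (H × H) :=
  (WithLp.prodContinuousLinearEquiv 2 ℂ H H).symm.toContinuousLinearMap ∘L
    ContinuousLinearMap.inl ℂ H H

variable (H) in
/-- The inclusion of `H` as the second summand of the Hilbert space `H ⊕ H`. -/
noncomputable def directSumInr : H →L[ℂ] WithLp 2 (H × H) :=
  (WithLp.prodContinuousLinearEquiv 2 ℂ H H).symm.toContinuousLinearMap ∘L
    ContinuousLinearMap.inr ℂ H H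

@[simp] theorem directSumInl_apply (x : H) : directSumInl H x = WithLp.toLp 2 (x, 0) := rfl

@[simp] theorem directSumInr_apply (x : H) : directSumInr H x = WithLp.toLp 2 (0, x) := rfl

/-- The operator matrix on `H ⊕ H` with `a` in the upper right corner and zeros elsewhere. -/
noncomputable def upperCorner :
    (H →L[ℂ] H) →ₗ[ℂ] (WithLp 2 (H × H) →L[ℂ] WithLp 2 (H × H)) where
  toFun a := directSumInl H ∘L a ∘L WithLp.sndL 2 ℂ H H
  map_add' a b := by simp only [add_comp, comp_add]
  map_smul' c a := by simp only [smul_comp, comp_smul, RingHom.id_apply]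

@[simp] theorem upperCorner_apply (a : H →L[ℂ] H) (x : WithLp 2 (H × H)) :
    upperCorner a x = WithLp.toLp 2 (a x.snd, 0) := rfl

theorem exists_norm_eq_one_norm_add_inner [Nontrivial H] (c : ℂ) (y : H) :
    ∃ k : H, ‖k‖ = 1 ∧ ‖c + ⟪k, y⟫_ℂ‖ = ‖c‖ + ‖y‖ := by
  obtain ⟨u, hu, huc⟩ := Complex.exists_norm_mul_eq_self c
  obtain ⟨e, he, hey⟩ : ∃ e : H, ‖e‖ = 1 ∧ (‖y‖ : ℂ) • e = y := by
    rcases eq_or_ne y 0 with rfl | hy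
    · obtain ⟨e, he⟩ := exists_norm_eq H zero_le_one
      exact ⟨e, he, by simp⟩
    · exact ⟨(‖y‖ : ℂ)⁻¹ • y, by simp [norm_smul, hy], smul_inv_smul₀ (by simpa using hy) y⟩
  refine ⟨star u • e, by rw [norm_smul, norm_star, hu, he, one_mul], ?_⟩
  have hphase : c + ⟪star u • e, y⟫_ℂ = u * ((‖c‖ + ‖y‖ : ℝ) : ℂ) := by
    conv_lhs => rw [← huc, ← hey, inner_smul_left, inner_smul_right, inner_self_eq_norm_sq_to_K, he]
    simp [mul_add]
  rw [hphase, norm_mul, hu, one_mul, Complex.norm_real, Real.norm_of_nonneg (by positivity)]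

theorem norm_add_inner_half_le_norm_smul_one_add_upperCorner (c : ℂ) (a : H →L[ℂ] H) {h k : H}
    (hh : ‖h‖ = 1) (hk : ‖k‖ = 1) : ‖c + ⟪k, a h⟫_ℂ / 2‖ ≤ ‖c • 1 + upperCorner a‖ := by
  set T := c • 1 + upperCorner a
  set x : WithLp 2 (H × H) := WithLp.toLp 2 (k, h)
  have hx : ‖x‖ ^ 2 = 2 := by
    rw [WithLp.prod_norm_sq_eq_of_L2]
    change ‖k‖ ^ 2 + ‖h‖ ^ 2 = 2
    rw [hh, hk]
    norm_num
  have hTx : ⟪x, T x⟫_ℂ = 2 * (c + ⟪k, a h⟫_ℂ / 2) := calc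
    ⟪x, T x⟫_ℂ = c * ⟪x, x⟫_ℂ + ⟪x, upperCorner a x⟫_ℂ := by
      rw [add_apply, smul_apply, one_apply_eq_self, inner_add_right, inner_smul_right]
    _ = c * ((‖x‖ ^ 2 : ℝ) : ℂ) + ⟪k, a h⟫_ℂ := by
      rw [inner_self_eq_norm_sq_to_K]
      simp [x]
    _ = 2 * (c + ⟪k, a h⟫_ℂ / 2) := by
      rw [hx]
      push_cast
      ring
  have hnum : ‖⟪x, T x⟫_ℂ‖ ≤ ‖T‖ * 2 := calc
    ‖⟪x, T x⟫_ℂ‖ ≤ ‖x‖ * (‖T‖ * ‖x‖) :=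
      (norm_inner_le_norm _ _).trans (by gcongr; exact T.le_opNorm x)
    _ = ‖T‖ * 2 := by rw [← hx]; ring
  rw [hTx, norm_mul, Complex.norm_ofNat] at hnum
  linarith

theorem norm_add_norm_half_le_norm_smul_one_add_upperCorner [Nontrivial H] (c : ℂ)
    (a : H →L[ℂ] H) : ‖c‖ + ‖a‖ / 2 ≤ ‖c • 1 + upperCorner a‖ := by
  set T := c • 1 + upperCorner a
  have hunit : ∀ h : H, ‖h‖ = 1 → ‖c‖ + ‖a h‖ / 2 ≤ ‖T‖ := fun h hh => by
    obtain ⟨k, hk, hck⟩ := exists_norm_eq_one_norm_add_inner (2 * c) (a h)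
    have hle := norm_add_inner_half_le_norm_smul_one_add_upperCorner c a hh hk
    have hdouble : 2 * c + ⟪k, a h⟫_ℂ = 2 * (c + ⟪k, a h⟫_ℂ / 2) := by ring
    rw [hdouble, norm_mul, norm_mul, Complex.norm_ofNat] at hck
    linarith
  obtain ⟨e, he⟩ := exists_norm_eq H zero_le_one
  have hc : ‖c‖ ≤ ‖T‖ := by linarith [hunit e he, norm_nonneg (a e)]
  have ha : ‖a‖ ≤ 2 * (‖T‖ - ‖c‖) :=
    opNorm_le_of_unit_norm (by linarith) fun h hh => by linarith [hunit h hh]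
  linarith

theorem exists_linearMap_one_upperCorner [Nontrivial H] (φ : (H →L[ℂ] H) →ₗ[ℂ] ℂ) :
    ∃ t : (WithLp 2 (H × H) →L[ℂ] WithLp 2 (H × H)) →ₗ[ℂ] ℂ,
      t 1 = 1 ∧ ∀ a, t (upperCorner a) = φ a := by
  obtain ⟨e, he⟩ := exists_norm_eq H zero_le_one
  refine ⟨{ toFun T := ⟪directSumInl H e, T (directSumInl H e)⟫_ℂ +
              φ (WithLp.fstL 2 ℂ H H ∘L T ∘L directSumInr H)
            map_add' T U := ?_
            map_smul' z T := ?_ }, ?_, fun a => ?_⟩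
  · simp only [add_apply, inner_add_right, add_comp, comp_add, map_add]
    ring
  · simp only [smul_apply, inner_smul_right, smul_comp, comp_smul, map_smul, smul_eq_mul,
      RingHom.id_apply]
    ring
  · have h0 : WithLp.fstL 2 ℂ H H ∘L 1 ∘L directSumInr H = 0 := by
      ext x
      simp
    simp [h0, he]
  · have ha : WithLp.fstL 2 ℂ H H ∘L upperCorner a ∘L directSumInr H = a := by
      ext x
      simp
    simp [ha]

theorem exists_unital_extension_upperCorner [Nontrivial H] {φ : StrongDual ℂ (H →L[ℂ] H)}
    (hφ : ‖φ‖ ≤ 1) :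
    ∃ g : StrongDual ℂ (WithLp 2 (H × H) →L[ℂ] WithLp 2 (H × H)),
      ‖g‖ ≤ 1 ∧ g 1 = 1 ∧ ∀ a, g (upperCorner a) = φ a / 2 := by
  let S : Submodule ℂ (WithLp 2 (H × H) →L[ℂ] WithLp 2 (H × H)) :=
    ℂ ∙ 1 ⊔ LinearMap.range upperCorner
  obtain ⟨t, ht1, htφ⟩ := exists_linearMap_one_upperCorner ((2⁻¹ : ℂ) • φ.toLinearMap)
  have htcorner : ∀ a, t (upperCorner a) = φ a / 2 := fun a =>
    (htφ a).trans (inv_mul_eq_div _ _)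
  have hbound : ∀ T ∈ S, ‖t T‖ ≤ ‖T‖ := fun T hT => by
    obtain ⟨_, hc, _, ⟨a, rfl⟩, rfl⟩ := Submodule.mem_sup.1 hT
    obtain ⟨c, rfl⟩ := Submodule.mem_span_singleton.1 hc
    calc ‖t (c • 1 + upperCorner a)‖ = ‖c + φ a / 2‖ := by
          rw [map_add, map_smul, ht1, htcorner, smul_eq_mul, mul_one]
      _ ≤ ‖c‖ + ‖φ a‖ / 2 := by
        simpa only [norm_div, Complex.norm_ofNat] using norm_add_le c (φ a / 2)
      _ ≤ ‖c‖ + ‖a‖ / 2 := by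
        gcongr
        simpa only [one_mul] using φ.le_of_opNorm_le hφ a
      _ ≤ _ := norm_add_norm_half_le_norm_smul_one_add_upperCorner c a
  obtain ⟨g, hgS, hg⟩ := exists_extension_norm_eq S
    ((t.domRestrict S).mkContinuous 1 fun T => (hbound T T.2).trans_eq (one_mul _).symm)
  refine ⟨g, hg.trans_le (LinearMap.mkContinuous_norm_le _ zero_le_one _), ?_, fun a => ?_⟩
  · exact (hgS ⟨1, Submodule.mem_sup_left (Submodule.mem_span_singleton_self 1)⟩).trans ht1
  · exact (hgS ⟨_, Submodule.mem_sup_right ⟨a, rfl⟩⟩).trans (htcorner a)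

variable [CompleteSpace H]

theorem adjoint_directSumInl : adjoint (directSumInl H) = WithLp.fstL 2 ℂ H H := by
  refine ((eq_adjoint_iff _ _).2 fun x y => ?_).symm
  simp

theorem adjoint_directSumInr : adjoint (directSumInr H) = WithLp.sndL 2 ℂ H H := by
  refine ((eq_adjoint_iff _ _).2 fun x y => ?_).symm
  simp

variable (H) in
/-- The embedding of `B(H)` into `B(H ⊕ H)` as the lower right corner. -/
noncomputable def lowerCorner :
    (H →L[ℂ] H) →⋆ₙₐ[ℂ] (WithLp 2 (H × H) →L[ℂ] WithLp 2 (H × H)) where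
  toFun a := directSumInr H ∘L a ∘L WithLp.sndL 2 ℂ H H
  map_smul' c a := by simp only [smul_comp, comp_smul, MonoidHom.id_apply]
  map_zero' := by simp only [zero_comp, comp_zero]
  map_add' a b := by simp only [add_comp, comp_add]
  map_mul' a b := by
    ext x
    simp
  map_star' a := by
    simp only [star_eq_adjoint, adjoint_comp, ← adjoint_directSumInr, adjoint_adjoint,
      comp_assoc]

theorem exists_representation_coefficient {φ : StrongDual ℂ (H →L[ℂ] H)} (hφ : ‖φ‖ ≤ 1) :
    ∃ (K : Type u) (_ : NormedAddCommGroup K) (_ : InnerProductSpace ℂ K) (_ : CompleteSpace K)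
      (ρ : (H →L[ℂ] H) →⋆ₙₐ[ℂ] (K →L[ℂ] K)) (ξ η : K),
      ‖η‖ * ‖ξ‖ ≤ 1 ∧ ∀ a, ⟪η, ρ a ξ⟫_ℂ = φ a := by
  rcases subsingleton_or_nontrivial H with _ | _
  · exact ⟨H, inferInstance, inferInstance, inferInstance, 0, 0, 0, by simp,
      fun a => by simp [Subsingleton.elim a 0]⟩
  let X := directSumInr H ∘L WithLp.fstL 2 ℂ H H
  let Y := directSumInr H ∘L WithLp.sndL 2 ℂ H H
  have hX : star X = directSumInl H ∘L WithLp.sndL 2 ℂ H H := by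
    rw [star_eq_adjoint, adjoint_comp, adjoint_directSumInr, ← adjoint_directSumInl,
      adjoint_adjoint]
  have hY : star Y = Y := by
    rw [star_eq_adjoint, adjoint_comp, adjoint_directSumInr]
    simp only [Y, ← adjoint_directSumInr, adjoint_adjoint]
  have hXY : star X * X + star Y * Y = 1 := by
    rw [hX, hY]
    ext ⟨x, y⟩
    simp [X, Y, ← WithLp.toLp_add]
  have hcorner : ∀ a, star X * lowerCorner H a * Y = upperCorner a := fun a => by
    rw [hX]
    ext x
    simp [lowerCorner, Y]
  obtain ⟨g, hg, hg1, hgφ⟩ := exists_unital_extension_upperCorner hφ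
  obtain ⟨K, _, _, _, π, ξ, η, hnorm, hπ⟩ :=
    exists_representation_inner_eq_map_star_mul_mul hg hg1 hXY
  refine ⟨K, inferInstance, inferInstance, inferInstance,
    (π : (WithLp 2 (H × H) →L[ℂ] WithLp 2 (H × H)) →⋆ₙₐ[ℂ] (K →L[ℂ] K)).comp (lowerCorner H),
    ξ, (2 : ℂ) • η, ?_, fun a => ?_⟩
  · rw [norm_smul, Complex.norm_ofNat]
    nlinarith [sq_nonneg (‖η‖ - ‖ξ‖)]
  · calc ⟪(2 : ℂ) • η, π (lowerCorner H a) ξ⟫_ℂ = 2 * (φ a / 2) := by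
          rw [inner_smul_left, hπ, hcorner, hgφ, Complex.conj_ofNat]
      _ = φ a := by ring

end Corner

section Compression

variable {R : Type*} [NonUnitalRing R] [Module ℂ R] {K : Type u} [NormedAddCommGroup K]
  [InnerProductSpace ℂ K]

/-- The restriction of a representation to an invariant subspace. -/
noncomputable def restrictRepresentation (ρ : R →ₙₐ[ℂ] (K →L[ℂ] K)) (M : Submodule ℂ K)
    (hM : ∀ r, ∀ x ∈ M, ρ r x ∈ M) : R →ₙₐ[ℂ] (M →L[ℂ] M) where
  toFun r := (ρ r).restrict (hM r)
  map_smul' c r := by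
    ext x
    simp
  map_zero' := by
    ext x
    simp
  map_add' r s := by
    ext x
    simp
  map_mul' r s := by
    ext x
    simp

@[simp] theorem coe_restrictRepresentation_apply (ρ : R →ₙₐ[ℂ] (K →L[ℂ] K)) (M : Submodule ℂ K)
    (hM : ∀ r, ∀ x ∈ M, ρ r x ∈ M) (r : R) (x : M) :
    (restrictRepresentation ρ M hM r x : K) = ρ r x := rfl

theorem norm_restrictRepresentation_le (ρ : R →ₙₐ[ℂ] (K →L[ℂ] K)) (M : Submodule ℂ K)
    (hM : ∀ r, ∀ x ∈ M, ρ r x ∈ M) (r : R) : ‖restrictRepresentation ρ M hM r‖ ≤ ‖ρ r‖ :=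
  opNorm_le_bound _ (norm_nonneg _) fun x => (ρ r).le_opNorm x

theorem orthogonalProjectionOnto_orthogonal_apply_of_invariant (M : Submodule ℂ K)
    [M.HasOrthogonalProjection] {T : K →L[ℂ] K} (hT : ∀ x ∈ M, T x ∈ M) (x : K) :
    Mᗮ.orthogonalProjectionOnto (T (Mᗮ.orthogonalProjectionOnto x)) =
      Mᗮ.orthogonalProjectionOnto (T x) := by
  rw [eq_comm, ← sub_eq_zero, ← map_sub, ← map_sub]
  refine Submodule.orthogonalProjectionOnto_orthogonal_apply_eq_zero (hT _ ?_)
  rw [Submodule.orthogonalProjectionOnto_orthogonal, sub_sub_cancel]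
  exact (M.orthogonalProjectionOnto x).2

/-- The compression of a representation to the orthogonal complement of an invariant subspace,
which is multiplicative although the orthogonal complement need not be invariant. -/
noncomputable def compressRepresentation (ρ : R →ₙₐ[ℂ] (K →L[ℂ] K)) (M : Submodule ℂ K)
    [M.HasOrthogonalProjection] (hM : ∀ r, ∀ x ∈ M, ρ r x ∈ M) : R →ₙₐ[ℂ] (Mᗮ →L[ℂ] Mᗮ) where
  toFun r := Mᗮ.orthogonalProjectionOnto ∘L ρ r ∘L Mᗮ.subtypeL
  map_smul' c r := by simp only [map_smul, smul_comp, comp_smul, MonoidHom.id_apply]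
  map_zero' := by simp only [map_zero, zero_comp, comp_zero]
  map_add' r s := by simp only [map_add, add_comp, comp_add]
  map_mul' r s := by
    refine ContinuousLinearMap.ext fun x => ?_
    simp only [map_mul, comp_apply, mul_apply_eq_comp, Submodule.subtypeL_apply]
    exact (orthogonalProjectionOnto_orthogonal_apply_of_invariant M (hM r) _).symm

@[simp] theorem compressRepresentation_apply (ρ : R →ₙₐ[ℂ] (K →L[ℂ] K)) (M : Submodule ℂ K)
    [M.HasOrthogonalProjection] (hM : ∀ r, ∀ x ∈ M, ρ r x ∈ M) (r : R) (x : Mᗮ) :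
    compressRepresentation ρ M hM r x = Mᗮ.orthogonalProjectionOnto (ρ r x) := rfl

theorem norm_compressRepresentation_le (ρ : R →ₙₐ[ℂ] (K →L[ℂ] K)) (M : Submodule ℂ K)
    [M.HasOrthogonalProjection] (hM : ∀ r, ∀ x ∈ M, ρ r x ∈ M) (r : R) :
    ‖compressRepresentation ρ M hM r‖ ≤ ‖ρ r‖ :=
  opNorm_le_bound _ (norm_nonneg _) fun x => by
    rw [compressRepresentation_apply]
    exact (Submodule.norm_orthogonalProjectionOnto_apply_le _ _).trans ((ρ r).le_opNorm x)

theorem exists_restriction_annihilating [CompleteSpace K] (ρ : R →ₙₐ[ℂ] (K →L[ℂ] K)) {J : Set R}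
    (hr : ∀ r, ∀ j ∈ J, j * r ∈ J) {ξ : K} (hξ : ∀ j ∈ J, ρ j ξ = 0) :
    ∃ (E : Type u) (_ : NormedAddCommGroup E) (_ : InnerProductSpace ℂ E) (_ : CompleteSpace E)
      (σ : R →ₙₐ[ℂ] (E →L[ℂ] E)), (∀ r, ‖σ r‖ ≤ ‖ρ r‖) ∧ (∀ j ∈ J, σ j = 0) ∧
        ∀ r, ‖ρ r ξ‖ ≤ ‖σ r‖ * ‖ξ‖ := by
  let E : Submodule ℂ K := ⨅ j ∈ J, (ρ j).ker
  have mem_E : ∀ x, x ∈ E ↔ ∀ j ∈ J, ρ j x = 0 := fun x => by simp [E]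
  have hE : ∀ r, ∀ x ∈ E, ρ r x ∈ E := fun r x hx => (mem_E _).2 fun j hj => by
    simpa only [map_mul, mul_apply_eq_comp] using (mem_E x).1 hx (j * r) (hr r j hj)
  have hclosed : IsClosed (E : Set K) := by
    simp only [E, Submodule.coe_iInf]
    exact isClosed_biInter fun j _ => (ρ j).isClosed_ker
  refine ⟨E, inferInstance, inferInstance, hclosed.completeSpace_coe,
    restrictRepresentation ρ E hE, norm_restrictRepresentation_le ρ E hE, fun j hj => ?_,
    fun r => (restrictRepresentation ρ E hE r).le_opNorm ⟨ξ, (mem_E ξ).2 hξ⟩⟩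
  ext x
  simpa using (mem_E x).1 x.2 j hj

theorem exists_representation_annihilating_ideal [CompleteSpace K] (ρ : R →ₙₐ[ℂ] (K →L[ℂ] K))
    {J : Submodule ℂ R} (hl : ∀ r, ∀ j ∈ J, r * j ∈ J) (hr : ∀ r, ∀ j ∈ J, j * r ∈ J) {ξ η : K}
    (hη : ∀ j ∈ J, ⟪η, ρ j ξ⟫_ℂ = 0) :
    ∃ (E : Type u) (_ : NormedAddCommGroup E) (_ : InnerProductSpace ℂ E) (_ : CompleteSpace E)
      (σ : R →ₙₐ[ℂ] (E →L[ℂ] E)), (∀ r, ‖σ r‖ ≤ ‖ρ r‖) ∧ (∀ j ∈ J, σ j = 0) ∧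
        ∀ r, ‖⟪η, ρ r ξ⟫_ℂ‖ ≤ ‖σ r‖ * (‖η‖ * ‖ξ‖) := by
  let M : Submodule ℂ K :=
    (J.map ((apply ℂ K ξ).toLinearMap ∘ₗ (ρ : R →ₗ[ℂ] (K →L[ℂ] K)))).topologicalClosure
  have : CompleteSpace M := (Submodule.isClosed_topologicalClosure _).completeSpace_coe
  have hJM : ∀ j ∈ J, ρ j ξ ∈ M := fun j hj =>
    Submodule.le_topologicalClosure _ (Submodule.mem_map_of_mem hj)
  have hM : ∀ r, ∀ x ∈ M, ρ r x ∈ M := fun r x hx => by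
    refine map_mem_closure (ρ r).continuous hx ?_
    rintro _ ⟨j, hj, rfl⟩
    exact ⟨r * j, hl r j hj, by simp⟩
  have hηM : η ∈ Mᗮ := by
    rw [Submodule.orthogonal_closure]
    rintro _ ⟨j, hj, rfl⟩
    exact inner_eq_zero_symm.1 (hη j hj)
  set ξ' : Mᗮ := Mᗮ.orthogonalProjectionOnto ξ
  have hξ' : ∀ r, compressRepresentation ρ M hM r ξ' = Mᗮ.orthogonalProjectionOnto (ρ r ξ) :=
    fun r => orthogonalProjectionOnto_orthogonal_apply_of_invariant M (hM r) ξ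
  obtain ⟨E, _, _, _, σ, hσ, hσJ, hσξ⟩ := exists_restriction_annihilating
    (compressRepresentation ρ M hM) (J := J) hr (ξ := ξ') fun j hj =>
      (hξ' j).trans (Submodule.orthogonalProjectionOnto_orthogonal_apply_eq_zero (hJM j hj))
  refine ⟨E, inferInstance, inferInstance, inferInstance, σ,
    fun r => (hσ r).trans (norm_compressRepresentation_le ρ M hM r), hσJ, fun r => ?_⟩
  calc ‖⟪η, ρ r ξ⟫_ℂ‖ = ‖⟪(⟨η, hηM⟩ : Mᗮ), compressRepresentation ρ M hM r ξ'⟫_ℂ‖ := by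
        rw [hξ', Submodule.inner_orthogonalProjectionOnto_eq_of_mem_left]
    _ ≤ ‖η‖ * (‖σ r‖ * ‖ξ'‖) :=
      (norm_inner_le_norm _ _).trans (mul_le_mul_of_nonneg_left (hσξ r) (norm_nonneg _))
    _ ≤ ‖η‖ * (‖σ r‖ * ‖ξ‖) := by
      gcongr
      exact Submodule.norm_orthogonalProjectionOnto_apply_le _ ξ
    _ = ‖σ r‖ * (‖η‖ * ‖ξ‖) := by ring

end Compression

section DirectSum

variable {R I : Type*} {K : I → Type*} [NonUnitalRing R] [Module ℂ R]
  [∀ i, NormedAddCommGroup (K i)] [∀ i, InnerProductSpace ℂ (K i)]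

/-- The Hilbert direct sum of a pointwise bounded family of representations. -/
noncomputable def directSumRepresentation (σ : ∀ i, R →ₙₐ[ℂ] (K i →L[ℂ] K i)) {C : R → ℝ}
    (hC : ∀ r, 0 ≤ C r) (hσ : ∀ i r, ‖σ i r‖ ≤ C r) : R →ₙₐ[ℂ] (lp K 2 →L[ℂ] lp K 2) where
  toFun r := lp.mapCLM 2 (fun i => σ i r) (hC r) fun i => hσ i r
  map_smul' c r := by
    ext x i
    simp
  map_zero' := by
    ext x i
    simp
  map_add' r s := by
    ext x i
    simp
  map_mul' r s := by
    ext x i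
    simp

variable {σ : ∀ i, R →ₙₐ[ℂ] (K i →L[ℂ] K i)} {C : R → ℝ} (hC : ∀ r, 0 ≤ C r)
  (hσ : ∀ i r, ‖σ i r‖ ≤ C r)

theorem directSumRepresentation_apply (r : R) (x : lp K 2) (i : I) :
    directSumRepresentation σ hC hσ r x i = σ i r (x i) := rfl

theorem norm_directSumRepresentation_le (r : R) : ‖directSumRepresentation σ hC hσ r‖ ≤ C r :=
  lp.norm_mapCLM_le 2 _ (hC r) fun i => hσ i r

theorem norm_le_norm_directSumRepresentation (i : I) (r : R) :
    ‖σ i r‖ ≤ ‖directSumRepresentation σ hC hσ r‖ := by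
  classical
  refine opNorm_le_bound _ (opNorm_nonneg _) fun x => ?_
  calc ‖σ i r x‖ = ‖directSumRepresentation σ hC hσ r (lp.single 2 i x) i‖ := by
        rw [directSumRepresentation_apply, lp.single_apply_self]
    _ ≤ ‖directSumRepresentation σ hC hσ r (lp.single 2 i x)‖ :=
      lp.norm_apply_le_norm two_ne_zero _ i
    _ ≤ ‖directSumRepresentation σ hC hσ r‖ * ‖lp.single 2 i x‖ := le_opNorm _ _
    _ = ‖directSumRepresentation σ hC hσ r‖ * ‖x‖ := by rw [lp.norm_single (by norm_num)]

end DirectSum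

theorem exists_functional_eq_infDist {𝕜 E : Type*} [RCLike 𝕜] [SeminormedAddCommGroup E]
    [NormedSpace 𝕜 E] (V : Submodule 𝕜 E) (x : E) :
    ∃ φ : StrongDual 𝕜 E, ‖φ‖ ≤ 1 ∧ (∀ v ∈ V, φ v = 0) ∧ φ x = (Metric.infDist x V : ℝ) := by
  obtain ⟨g, hg, hgx⟩ := exists_dual_vector'' 𝕜 (V.mkQ x)
  let φ : E →ₗ[𝕜] 𝕜 := g.toLinearMap ∘ₗ V.mkQ
  have hφ : ∀ y, ‖φ y‖ ≤ 1 * ‖y‖ := fun y =>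
    g.le_of_opNorm_le_of_le hg QuotientAddGroup.norm_mk_le_norm
  refine ⟨φ.mkContinuous 1 hφ, φ.mkContinuous_norm_le zero_le_one hφ, fun v hv => ?_, ?_⟩
  · simp [φ, (Submodule.Quotient.mk_eq_zero V).2 hv]
  · exact hgx.trans (congrArg _ (QuotientAddGroup.norm_mk x))

section Quotient

variable {R : Type*} {H : Type u} [NonUnitalRing R] [Module ℂ R] [NormedAddCommGroup H]
  [InnerProductSpace ℂ H] [CompleteSpace H]

theorem exists_representation_norm_le_infDist (ι : R →ₙₐ[ℂ] (H →L[ℂ] H)) {J : Submodule ℂ R}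
    (hl : ∀ r, ∀ j ∈ J, r * j ∈ J) (hr : ∀ r, ∀ j ∈ J, j * r ∈ J) (s : R) :
    ∃ (E : Type u) (_ : NormedAddCommGroup E) (_ : InnerProductSpace ℂ E) (_ : CompleteSpace E)
      (σ : R →ₙₐ[ℂ] (E →L[ℂ] E)), (∀ r, ‖σ r‖ ≤ Metric.infDist (ι r) (ι '' J)) ∧
        Metric.infDist (ι s) (ι '' J) ≤ ‖σ s‖ := by
  obtain ⟨φ, hφ, hφJ, hφs⟩ :=
    exists_functional_eq_infDist (J.map (ι : R →ₗ[ℂ] (H →L[ℂ] H))) (ι s)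
  obtain ⟨K, _, _, _, ρ, ξ, η, hξη, hρ⟩ := exists_representation_coefficient hφ
  obtain ⟨E, _, _, _, σ, hσ, hσJ, hσξ⟩ := exists_representation_annihilating_ideal
    ((ρ : (H →L[ℂ] H) →ₙₐ[ℂ] (K →L[ℂ] K)).comp ι) hl hr (ξ := ξ) (η := η)
    fun j hj => (hρ _).trans (hφJ _ (Submodule.mem_map_of_mem hj))
  refine ⟨E, inferInstance, inferInstance, inferInstance, σ, fun r => ?_, ?_⟩
  · refine (Metric.le_infDist (J.nonempty.image ι)).2 ?_
    rintro _ ⟨j, hj, rfl⟩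
    calc ‖σ r‖ = ‖σ (r - j)‖ := by rw [map_sub, hσJ j hj, sub_zero]
      _ ≤ ‖ρ (ι (r - j))‖ := hσ _
      _ ≤ ‖ι (r - j)‖ := NonUnitalStarAlgHom.norm_apply_le ρ _
      _ = dist (ι r) (ι j) := by rw [map_sub, dist_eq_norm]
  · calc Metric.infDist (ι s) (ι '' J) = ‖φ (ι s)‖ := by
          rw [hφs, RCLike.norm_ofReal, abs_of_nonneg Metric.infDist_nonneg]
          rfl
      _ = ‖⟪η, ρ (ι s) ξ⟫_ℂ‖ := by rw [hρ]
      _ ≤ ‖σ s‖ * (‖η‖ * ‖ξ‖) := hσξ s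
      _ ≤ ‖σ s‖ := mul_le_of_le_one_right (norm_nonneg _) hξη

/-- The **Cole–Lumer–Bernard theorem** on quotients of operator algebras. -/
theorem exists_representation_norm_eq_infDist {R : Type v} [NonUnitalRing R] [Module ℂ R]
    (ι : R →ₙₐ[ℂ] (H →L[ℂ] H)) {J : Submodule ℂ R}
    (hl : ∀ r, ∀ j ∈ J, r * j ∈ J) (hr : ∀ r, ∀ j ∈ J, j * r ∈ J) :
    ∃ (K : Type (max u v)) (_ : NormedAddCommGroup K) (_ : InnerProductSpace ℂ K)
      (_ : CompleteSpace K) (τ : R →ₙₐ[ℂ] (K →L[ℂ] K)),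
      ∀ r, ‖τ r‖ = Metric.infDist (ι r) (ι '' J) := by
  choose K _ _ _ σ hσ hσs using exists_representation_norm_le_infDist ι hl hr
  exact ⟨lp K 2, inferInstance, inferInstance, inferInstance,
    directSumRepresentation σ (fun _ => Metric.infDist_nonneg) hσ, fun r =>
      le_antisymm (norm_directSumRepresentation_le _ hσ r)
        ((hσs r).trans (norm_le_norm_directSumRepresentation _ hσ r r))⟩

end Quotient

section Algebraic

variable {A : Type*} [NonUnitalRing A] [Module ℂ A] {P : A →ₗ[ℂ] A}

theorem mem_projN_iff {x : A} :
    x ∈ projN P ↔ P x = 0 ∧ ∀ y, P (x * y) = 0 ∧ P (y * x) = 0 := by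
  have unitalExtension_eq_zero : ∀ y : Unitization ℂ A,
      (unitalExtension P (Unitization.inr x * y) = 0 ∧
        unitalExtension P (y * Unitization.inr x) = 0) ↔
      (y.fst • P x + P (x * y.snd) = 0 ∧ y.fst • P x + P (y.snd * x) = 0) := fun y => by
    simp [unitalExtension, Unitization.ext_iff]
  refine (forall_congr' unitalExtension_eq_zero).trans ⟨fun h => ?_, fun ⟨h0, h⟩ y => ?_⟩
  · exact ⟨by simpa using (h 1).1, fun y => by simpa using h (Unitization.inr y)⟩
  · simp [h0, h y.snd]

theorem zero_mem_projN : (0 : A) ∈ projN P := mem_projN_iff.2 (by simp)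

theorem projN_subset_projB : projN P ⊆ projB P := fun x hx y => by
  obtain ⟨h0, h⟩ := mem_projN_iff.1 hx
  simp [h0, h y]

theorem mem_projN_of_mem_projB {x : A} (hx : x ∈ projB P) (h0 : P x = 0) : x ∈ projN P :=
  mem_projN_iff.2 ⟨h0, fun y => by simp [hx y, h0]⟩

theorem add_mem_projB {x y : A} (hx : x ∈ projB P) (hy : y ∈ projB P) : x + y ∈ projB P :=
  fun z => by simp [add_mul, mul_add, hx z, hy z]

theorem sub_mem_projB {x y : A} (hx : x ∈ projB P) (hy : y ∈ projB P) : x - y ∈ projB P :=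
  fun z => by simp [sub_mul, mul_sub, hx z, hy z]

theorem range_subset_projB_iff_isPConditionalExpectation (hP : ∀ a, P (P a) = P a) :
    Set.range P ⊆ projB P ↔ IsPConditionalExpectation P := by
  refine ⟨fun h a b => ⟨?_, ?_⟩, ?_⟩
  · simpa only [hP] using (h ⟨a, rfl⟩ b).1
  · simpa only [hP] using (h ⟨b, rfl⟩ a).2.symm
  · rintro h _ ⟨a, rfl⟩ y
    rw [hP]
    exact ⟨(h a y).1, (h y a).2.symm⟩

theorem range_subset_projB_iff_projB_eq_range_add_projN (hP : ∀ a, P (P a) = P a) :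
    Set.range P ⊆ projB P ↔ projB P = Set.range P + projN P := by
  refine ⟨fun h => Set.Subset.antisymm (fun x hx => ?_) ?_, fun h x hx => ?_⟩
  · have hker : x - P x ∈ projN P :=
      mem_projN_of_mem_projB (sub_mem_projB hx (h ⟨x, rfl⟩)) (by rw [map_sub, hP, sub_self])
    exact Set.mem_add.2 ⟨P x, ⟨x, rfl⟩, x - P x, hker, add_sub_cancel _ _⟩
  · rintro _ ⟨x, hx, n, hn, rfl⟩
    exact add_mem_projB (h hx) (projN_subset_projB hn)
  · rw [h]
    exact Set.mem_add.2 ⟨x, hx, 0, zero_mem_projN, add_zero x⟩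

variable [IsScalarTower ℂ A A] [SMulCommClass ℂ A A]

/-- The set `B` as a subalgebra of `A`, when it contains the range of the projection `P`. -/
def projBSubalgebra (hP : ∀ a, P (P a) = P a) (h : Set.range P ⊆ projB P) :
    NonUnitalSubalgebra ℂ A where
  carrier := projB P
  add_mem' := add_mem_projB
  zero_mem' := projN_subset_projB zero_mem_projN
  smul_mem' c x hx y := by simp [smul_mul_assoc, mul_smul_comm, hx y]
  mul_mem' {x y} hx hy z := by
    have hE := (range_subset_projB_iff_isPConditionalExpectation hP).1 h
    constructor
    · rw [mul_assoc, (hx _).1, (hy z).1, (hx y).1, ← (hE _ _).1, (hE _ _).2, mul_assoc]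
    · rw [← mul_assoc, (hy _).2, (hx z).2, (hx y).1, (hE _ _).2, ← (hE _ _).1, mul_assoc]

end Algebraic

theorem infDist_ker_eq_norm {𝕜 E F : Type*} [NormedField 𝕜] [SeminormedAddCommGroup E]
    [SeminormedAddCommGroup F] [Module 𝕜 E] [Module 𝕜 F] {f : E →ₗ[𝕜] F}
    (hf : ∀ x, ‖f x‖ ≤ ‖x‖) {x y : E} (hxy : f y = f x) (hy : ‖y‖ ≤ ‖f x‖) :
    Metric.infDist x (LinearMap.ker f) = ‖f x‖ := by
  refine le_antisymm ?_ ((Metric.le_infDist (LinearMap.ker f).nonempty).2 fun k hk => ?_)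
  · have hker : x - y ∈ LinearMap.ker f := by rw [LinearMap.mem_ker, map_sub, hxy, sub_self]
    calc Metric.infDist x (LinearMap.ker f) ≤ dist x (x - y) := Metric.infDist_le_dist_of_mem hker
      _ = ‖y‖ := by rw [dist_eq_norm, sub_sub_cancel]
      _ ≤ ‖f x‖ := hy
  · calc ‖f x‖ = ‖f (x - k)‖ := by rw [map_sub, LinearMap.mem_ker.1 hk, sub_zero]
      _ ≤ dist x k := (hf _).trans_eq (dist_eq_norm x k).symm

section Range

variable {A H : Type u} [NonUnitalNormedRing A] [Module ℂ A] [IsScalarTower ℂ A A]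
  [SMulCommClass ℂ A A] [NormedAddCommGroup H] [InnerProductSpace ℂ H] [CompleteSpace H]
  {P : A →ₗ[ℂ] A}

theorem exists_representation_projBSubalgebra {ι : A →ₙₐ[ℂ] (H →L[ℂ] H)} (hι : Isometry ι)
    (hP : ∀ a, P (P a) = P a) (hPc : ∀ a, ‖P a‖ ≤ ‖a‖) (h : Set.range P ⊆ projB P) :
    ∃ (K : Type u) (_ : NormedAddCommGroup K) (_ : InnerProductSpace ℂ K) (_ : CompleteSpace K)
      (τ : projBSubalgebra hP h →ₙₐ[ℂ] (K →L[ℂ] K)), ∀ x, ‖τ x‖ = ‖P x‖ := by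
  let S := projBSubalgebra hP h
  let f : S →ₗ[ℂ] A := P ∘ₗ S.toSubmodule.subtype
  have hl : ∀ r, ∀ j ∈ LinearMap.ker f, r * j ∈ LinearMap.ker f := fun r j (hj : P j = 0) =>
    (j.2 r).2.trans (by rw [hj, mul_zero, map_zero])
  have hr : ∀ r, ∀ j ∈ LinearMap.ker f, j * r ∈ LinearMap.ker f := fun r j (hj : P j = 0) =>
    (j.2 r).1.trans (by rw [hj, zero_mul, map_zero])
  have hιS : Isometry (ι.comp (NonUnitalSubalgebraClass.subtype S)) :=
    hι.comp isometry_subtype_coe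
  obtain ⟨K, _, _, _, τ, hτ⟩ := exists_representation_norm_eq_infDist
    (ι.comp (NonUnitalSubalgebraClass.subtype S)) hl hr
  refine ⟨K, inferInstance, inferInstance, inferInstance, τ, fun x => ?_⟩
  rw [hτ, Metric.infDist_image hιS]
  exact infDist_ker_eq_norm (f := f) (fun y => hPc y) (y := ⟨P x, h ⟨x, rfl⟩⟩) (hP x) le_rfl

theorem exists_linearIsometry_range {ι : A →ₙₐ[ℂ] (H →L[ℂ] H)} (hι : Isometry ι)
    (hP : ∀ a, P (P a) = P a) (hPc : ∀ a, ‖P a‖ ≤ ‖a‖) (h : Set.range P ⊆ projB P) :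
    ∃ (K : Type u) (_ : NormedAddCommGroup K) (_ : InnerProductSpace ℂ K) (_ : CompleteSpace K)
      (Θ : LinearMap.range P →ₗᵢ[ℂ] (K →L[ℂ] K)), ∀ x y, Θ (pProduct P x y) = Θ x * Θ y := by
  obtain ⟨K, _, _, _, τ, hτ⟩ := exists_representation_projBSubalgebra hι hP hPc h
  have τ_congr : ∀ x y : projBSubalgebra hP h, P x = P y → τ x = τ y := fun x y hxy => by
    rw [← sub_eq_zero, ← map_sub, ← norm_eq_zero, hτ]
    change ‖P (x - y)‖ = 0
    rw [map_sub, hxy, sub_self, norm_zero]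
  have P_coe : ∀ x : LinearMap.range P, P x = x := by
    rintro ⟨_, a, rfl⟩
    exact hP a
  let inc : LinearMap.range P →ₗ[ℂ] projBSubalgebra hP h :=
    Submodule.inclusion (p' := (projBSubalgebra hP h).toSubmodule) h
  refine ⟨K, inferInstance, inferInstance, inferInstance,
    ⟨(τ : projBSubalgebra hP h →ₗ[ℂ] (K →L[ℂ] K)) ∘ₗ inc, fun x => ?_⟩, fun x y => ?_⟩
  · exact (hτ (inc x)).trans (congrArg norm (P_coe x))
  · exact (τ_congr _ _ (hP _)).trans (map_mul τ (inc x) (inc y))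

theorem exists_linearIsometryEquiv_range_isOperatorAlgebra [CompleteSpace A]
    {ι : A →ₙₐ[ℂ] (H →L[ℂ] H)} (hι : Isometry ι)
    (hP : ∀ a, P (P a) = P a) (hPc : ∀ a, ‖P a‖ ≤ ‖a‖) (h : Set.range P ⊆ projB P) :
    ∃ (K : Type u) (_ : NormedAddCommGroup K) (_ : InnerProductSpace ℂ K)
      (_ : CompleteSpace K) (D : NonUnitalSubalgebra ℂ (K →L[ℂ] K))
      (φ : LinearMap.range P ≃ₗᵢ[ℂ] D),
      IsOperatorAlgebra D ∧ ∀ x y, φ (pProduct P x y) = φ x * φ y := by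
  obtain ⟨K, _, _, _, Θ, hΘ⟩ := exists_linearIsometry_range hι hP hPc h
  let D : NonUnitalSubalgebra ℂ (K →L[ℂ] K) :=
    { LinearMap.range Θ.toLinearMap with
      mul_mem' := by
        rintro _ _ ⟨x, rfl⟩ ⟨y, rfl⟩
        exact ⟨pProduct P x y, hΘ x y⟩ }
  have hidem : IsIdempotentElem (P.mkContinuous 1 fun a => by simpa using hPc a) :=
    ContinuousLinearMap.ext hP
  have : CompleteSpace (LinearMap.range P) := hidem.isClosed_range.completeSpace_coe
  exact ⟨K, inferInstance, inferInstance, inferInstance, D, Θ.equivRange,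
    Θ.isometry.isClosedEmbedding.isClosed_range, fun x y => Subtype.ext (hΘ x y)⟩

end Range

theorem theorem5p10_general {H : Type u} [NormedAddCommGroup H] [InnerProductSpace ℂ H]
    [CompleteSpace H] (A : NonUnitalSubalgebra ℂ (H →L[ℂ] H)) (hA : IsOperatorAlgebra A)
    (P : A →ₗ[ℂ] A) (hP : ∀ a, P (P a) = P a) (hPc : ∀ a, ‖P a‖ ≤ ‖a‖) :
    (Set.range P ⊆ projB P ↔ IsPConditionalExpectation P) ∧
    (Set.range P ⊆ projB P ↔ projB P = Set.range P + projN P) ∧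
    (Set.range P ⊆ projB P →
      (∃ (K : Type u) (_ : NormedAddCommGroup K) (_ : InnerProductSpace ℂ K)
          (_ : CompleteSpace K) (D : NonUnitalSubalgebra ℂ (K →L[ℂ] K))
          (φ : LinearMap.range P ≃ₗᵢ[ℂ] D),
          IsOperatorAlgebra D ∧ ∀ x y, φ (pProduct P x y) = φ x * φ y) ∧
      (∃ S : NonUnitalSubalgebra ℂ A, (S : Set A) = projB P ∧ Set.range P ⊆ (S : Set A) ∧
        (∀ x ∈ S, ∀ y ∈ S,
          P.rangeRestrict (x * y) = pProduct P (P.rangeRestrict x) (P.rangeRestrict y)) ∧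
        P.rangeRestrict '' (S : Set A) = Set.univ)) := by
  refine ⟨range_subset_projB_iff_isPConditionalExpectation hP,
    range_subset_projB_iff_projB_eq_range_add_projN hP, fun h => ⟨?_, ?_⟩⟩
  · have hcl : IsClosed (A : Set (H →L[ℂ] H)) := hA
    have : CompleteSpace A := hcl.completeSpace_coe
    have hι : Isometry (NonUnitalSubalgebraClass.subtype A) := isometry_subtype_coe
    exact exists_linearIsometryEquiv_range_isOperatorAlgebra hι hP hPc h
  · refine ⟨projBSubalgebra hP h, rfl, h, fun x hx y _ => Subtype.ext (hx y).1,
      Set.eq_univ_of_forall ?_⟩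
    rintro ⟨_, a, rfl⟩
    exact ⟨P a, h ⟨a, rfl⟩, Subtype.ext (hP a)⟩

theorem theorem5p10 {H : Type u} [NormedAddCommGroup H] [InnerProductSpace ℂ H] [CompleteSpace H]
    (A : NonUnitalSubalgebra ℂ (H →L[ℂ] H)) (hA : IsOperatorAlgebra A)
    (hA1 : ApproximatelyUnital A) (P : A →ₗ[ℂ] A)
    (hP : IsRealPositiveContractiveProjection P) :
    (Set.range P ⊆ projB P ↔ IsPConditionalExpectation P) ∧
    (Set.range P ⊆ projB P ↔ projB P = Set.range P + projN P) ∧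
    (Set.range P ⊆ projB P →
      -- `P(A)` with the `P`-product is isometrically isomorphic to an operator algebra
      (∃ (K : Type u) (_ : NormedAddCommGroup K) (_ : InnerProductSpace ℂ K)
          (_ : CompleteSpace K) (D : NonUnitalSubalgebra ℂ (K →L[ℂ] K))
          (φ : LinearMap.range P ≃ₗᵢ[ℂ] D),
          IsOperatorAlgebra D ∧ ∀ x y, φ (pProduct P x y) = φ x * φ y) ∧
      -- `B` is a subalgebra containing `P(A)`, and `P` is a homomorphism from `B` onto `P(A)`
      (∃ S : NonUnitalSubalgebra ℂ A, (S : Set A) = projB P ∧ Set.range P ⊆ (S : Set A) ∧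
        (∀ x ∈ S, ∀ y ∈ S,
          P.rangeRestrict (x * y) = pProduct P (P.rangeRestrict x) (P.rangeRestrict y)) ∧
        P.rangeRestrict '' (S : Set A) = Set.univ)) :=
  theorem5p10_general A hA P hP.idempotent hP.contractive
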